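/- Let $G$ be a finite, connected, loopless simple graph and let $r$ be a positive integer such that $\operatorname{diam}(G)\ge r$. Write $|G|$ for the number of vertices of $G$, $\delta(G)$ for its minimum degree, and $G^r$ for the loopless graph on the vertex set of $G$ in which two distinct vertices are adjacent exactly when their distance in $G$ is at most $r$; let $e(G^r)$ be the number of edges of $G^r$. - If $r\equiv 0 \pmod 3$, then $$e(G^r)\;\ge\;\left(\frac{r+3}{6}-\frac{3}{4(r+3)}\right)\delta(G)\,|G|.$$ - If $r\not\equiv 0 \pmod 3$, then $$e(G^r)\;\ge\;\frac12\left\lceil \frac r3\right\rceil \delta(G)\,|G|.$$ -/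

import Mathlib

/-- The `r`th power of a loopless graph `G`: the loopless graph on the same vertex set in which two
distinct vertices are adjacent when their distance in `G` is at most `r`. The extended distance is
used, so that vertices in different components are never adjacent. -/
def graphPower {V : Type*} (G : SimpleGraph V) (r : ℕ) : SimpleGraph V where
  Adj x y := x ≠ y ∧ G.edist x y ≤ (r : ℕ∞)
  symm := ⟨fun x y h => ⟨h.1.symm, by rw [SimpleGraph.edist_comm]; exact h.2⟩⟩
  loopless := ⟨fun _ h => h.1 rfl⟩

open SimpleGraph Finset

/-! Twice e(G^r) is the sum over `u` of |B(u,r)| - 1, so balls must be large on average. Unit balls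
around every third vertex of a geodesic are disjoint, with at least δ+1 vertices each. If 3 ∤ r and
k = ⌊r/3⌋, this already puts (k+1)(δ+1) vertices in every ball (`le_card_distBall`).

For r = 3k the last unit ball may stick out, and some |B(u,r)| - 1 fall short of (k+1)δ. Two such
vertices are at distance at most 2 or at least 3k (`dist_le_two_or_le_dist_of_small`), so they form
clusters. If c of them lie near a centre of deficit D, then D + c ≤ δ, so a cluster costs at most
δ²/4 (`exists_separated_sum_deficit_le`). Centres are few, since balls of about half the radius
around them hardly overlap; a vertex in many of these has a ball whose surplus pays for the overlap
(`card_near_mul_le`). -/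

/-- The closed ball of radius `R` around `v` in the graph metric. -/
noncomputable def distBall {V : Type*} [Fintype V] (G : SimpleGraph V) (v : V) (R : ℕ) : Finset V :=
  univ.filter fun x => G.dist v x ≤ R

theorem mem_distBall {V : Type*} [Fintype V] {G : SimpleGraph V} {v x : V} {R : ℕ} :
    x ∈ distBall G v R ↔ G.dist v x ≤ R := by
  simp [distBall]

theorem distBall_subset {V : Type*} [Fintype V] {G : SimpleGraph V} (hG : G.Connected)
    {v w : V} {R T : ℕ} (h : G.dist v w + R ≤ T) : distBall G w R ⊆ distBall G v T := by
  intro x hx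
  rw [mem_distBall] at *
  have := hG.dist_triangle (u := v) (v := w) (w := x)
  omega

theorem disjoint_distBall {V : Type*} [Fintype V] {G : SimpleGraph V} (hG : G.Connected)
    {v w : V} {R T : ℕ} (h : R + T < G.dist v w) :
    Disjoint (distBall G v R) (distBall G w T) := by
  rw [Finset.disjoint_left]
  intro x hx hx'
  rw [mem_distBall] at *
  have := hG.dist_triangle (u := v) (v := x) (w := w)
  rw [G.dist_comm (u := w)] at hx'
  omega

/-- Geodesics, parametrised by `ℕ`. -/
theorem SimpleGraph.Connected.exists_geodesic {V : Type*} {G : SimpleGraph V} (hG : G.Connected)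
    {v x : V} {L : ℕ} (h : L ≤ G.dist v x) :
    ∃ p : ℕ → V, p 0 = v ∧ ∀ i j, i ≤ j → j ≤ L → G.dist (p i) (p j) = j - i := by
  obtain ⟨q, hq⟩ := hG.exists_walk_length_eq_dist v x
  refine ⟨q.getVert, q.getVert_zero, ?_⟩
  have step : ∀ i j, i ≤ j → G.dist (q.getVert i) (q.getVert j) ≤ j - i := by
    intro i j hij
    induction j, hij using Nat.le_induction with
    | base => simp
    | succ j hij ih =>
      have h1 : G.dist (q.getVert j) (q.getVert (j + 1)) ≤ 1 := by
        by_cases hj : j < q.length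
        · exact (dist_eq_one_iff_adj.2 (q.adj_getVert_succ hj)).le
        · rw [q.getVert_of_length_le (by omega), q.getVert_of_length_le (by omega)]; simp
      have := hG.dist_triangle (u := q.getVert i) (v := q.getVert j) (w := q.getVert (j + 1))
      omega
  intro i j hij hj
  have h1 := step i j hij
  have h2 := step 0 i (by omega)
  have h3 := step j q.length (by omega)
  rw [q.getVert_zero] at h2
  rw [q.getVert_length] at h3
  have h4 := hG.dist_triangle (u := v) (v := q.getVert i) (w := x)
  have h5 := hG.dist_triangle (u := q.getVert i) (v := q.getVert j) (w := x)
  omega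

/-! ### Packing unit balls along geodesics -/

/-- Unit balls around vertices at pairwise distance at least three are disjoint. -/
theorem card_mul_le_card_of_separated {V ι : Type*} [Fintype V] {G : SimpleGraph V}
    (hG : G.Connected) {δ : ℕ} (hδ : ∀ v, δ + 1 ≤ (distBall G v 1).card) (I : Finset ι) (c : ι → V)
    (hc : ∀ i ∈ I, ∀ j ∈ I, i ≠ j → 3 ≤ G.dist (c i) (c j)) (B : Finset V)
    (hB : ∀ i ∈ I, distBall G (c i) 1 ⊆ B) : I.card * (δ + 1) ≤ B.card := by
  classical
  calc I.card * (δ + 1) = ∑ _i ∈ I, (δ + 1) := by simp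
    _ ≤ ∑ i ∈ I, (distBall G (c i) 1).card := Finset.sum_le_sum fun i _ => hδ _
    _ = (I.biUnion fun i => distBall G (c i) 1).card := by
      rw [Finset.card_biUnion]
      intro i hi j hj hij
      exact disjoint_distBall hG (by have := hc i hi j hj hij; omega)
    _ ≤ B.card := Finset.card_le_card (Finset.biUnion_subset.2 hB)

theorem separated_of_geodesic {V : Type*} {G : SimpleGraph V} {p : ℕ → V} {L : ℕ}
    (hp : ∀ i j, i ≤ j → j ≤ L → G.dist (p i) (p j) = j - i) {s i j : ℕ} (hi : 3 * i + s ≤ L)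
    (hj : 3 * j + s ≤ L) (hij : i ≠ j) : 3 ≤ G.dist (p (3 * i + s)) (p (3 * j + s)) := by
  rcases lt_or_gt_of_ne hij with h | h
  · rw [hp _ _ (by omega) (by omega)]; omega
  · rw [G.dist_comm, hp _ _ (by omega) (by omega)]; omega

theorem le_card_distBall_of_le_dist {V : Type*} [Fintype V] {G : SimpleGraph V}
    (hG : G.Connected) {δ : ℕ} (hδ : ∀ v, δ + 1 ≤ (distBall G v 1).card) {v x : V} {j : ℕ}
    (h : 3 * j ≤ G.dist v x) : (j + 1) * (δ + 1) ≤ (distBall G v (3 * j + 1)).card := by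
  obtain ⟨p, hp0, hp⟩ := hG.exists_geodesic h
  have := card_mul_le_card_of_separated hG hδ (range (j + 1)) (fun i => p (3 * i + 0))
    (fun i hi i' hi' hne => separated_of_geodesic hp
      (by have := mem_range.1 hi; omega) (by have := mem_range.1 hi'; omega) hne)
    (distBall G v (3 * j + 1)) (fun i hi => by
      have hi := mem_range.1 hi
      apply distBall_subset hG
      rw [← hp0, hp _ _ (by omega) (by omega)]; omega)
  simpa using this

/-- In a graph of diameter at least `3 * k`, a vertex whose ball of radius `R` is small has
eccentricity at least `3 * k`. -/
theorem exists_le_dist_of_card_distBall_lt {V : Type*} [Fintype V] {G : SimpleGraph V}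
    (hG : G.Connected) {δ : ℕ} (hδ : ∀ v, δ + 1 ≤ (distBall G v 1).card) {a b : V} {k R : ℕ}
    (hab : 3 * k ≤ G.dist a b) (hR : 3 * k ≤ R) {v : V}
    (hv : (distBall G v R).card < (k + 1) * (δ + 1)) : ∃ x, 3 * k ≤ G.dist v x := by
  by_contra! hcon
  have h1 := le_card_distBall_of_le_dist hG hδ hab
  -- Small eccentricity makes the ball around `v` all of `V`, so it contains the large ball around
  -- `a`.
  have h2 : distBall G a (3 * k + 1) ⊆ distBall G v R := fun x _ =>
    mem_distBall.2 (by have := hcon x; omega)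
  have := card_le_card h2
  omega

theorem le_card_distBall {V : Type*} [Fintype V] {G : SimpleGraph V}
    (hG : G.Connected) {δ : ℕ} (hδ : ∀ v, δ + 1 ≤ (distBall G v 1).card) {a b : V} {k R : ℕ}
    (hab : 3 * k ≤ G.dist a b) (hR : 3 * k + 1 ≤ R) (v : V) :
    (k + 1) * (δ + 1) ≤ (distBall G v R).card := by
  by_contra! hv
  obtain ⟨x, hx⟩ := exists_le_dist_of_card_distBall_lt hG hδ hab (by omega) hv
  have h1 := le_card_distBall_of_le_dist hG hδ hx
  have h2 : distBall G v (3 * k + 1) ⊆ distBall G v R := distBall_subset hG (by simpa using hR)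
  have := card_le_card h2
  omega

/-- A vertex from which all of `p 0, p 3, …, p (3 * k)` are within distance `3 * k - 1` has a
large ball of radius `3 * k`. -/
theorem le_card_distBall_of_geodesic {V : Type*} [Fintype V] {G : SimpleGraph V}
    (hG : G.Connected) {δ : ℕ} (hδ : ∀ v, δ + 1 ≤ (distBall G v 1).card) {k : ℕ} {p : ℕ → V}
    (hp : ∀ i j, i ≤ j → j ≤ 3 * k → G.dist (p i) (p j) = j - i) {w : V}
    (hw : ∀ i ≤ k, G.dist w (p (3 * i)) + 1 ≤ 3 * k) :
    (k + 1) * (δ + 1) ≤ (distBall G w (3 * k)).card := by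
  have := card_mul_le_card_of_separated hG hδ (range (k + 1)) (fun i => p (3 * i + 0))
    (fun i hi i' hi' hne => separated_of_geodesic hp
      (by have := mem_range.1 hi; omega) (by have := mem_range.1 hi'; omega) hne)
    (distBall G w (3 * k)) (fun i hi => distBall_subset hG (hw i (by
      have := mem_range.1 hi; omega)))
  simpa using this

/-! ### Clusters of vertices with small balls -/

/-- Two vertices with small balls of radius `3 * k` are either close or far apart. -/
theorem dist_le_two_or_le_dist_of_small {V : Type*} [Fintype V] {G : SimpleGraph V}
    (hG : G.Connected) {δ : ℕ} (hδ : ∀ v, δ + 1 ≤ (distBall G v 1).card) {k : ℕ} {v w x : V}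
    (hx : 3 * k ≤ G.dist v x)
    (hv : (distBall G v (3 * k)).card < (k + 1) * (δ + 1))
    (hw : (distBall G w (3 * k)).card < (k + 1) * (δ + 1)) :
    G.dist v w ≤ 2 ∨ 3 * k ≤ G.dist v w := by
  by_contra! hcon
  obtain ⟨p, hp0, hp⟩ := hG.exists_geodesic hx
  -- If `w` is far from these centres, it replaces `p (3 * k)`, whose unit ball may leave the ball
  -- around `v`. Otherwise `w` is within 2 of an interior centre, hence within 2 + 3(k-1) of all of
  -- them.
  by_cases hfar : ∀ j < k, 3 ≤ G.dist w (p (3 * j))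
  · have := card_mul_le_card_of_separated hG hδ (range (k + 1))
      (fun i => if i < k then p (3 * i + 0) else w)
      (fun i hi i' hi' hne => by
        have hi := mem_range.1 hi
        have hi' := mem_range.1 hi'
        split_ifs with h1 h2 h2
        · exact separated_of_geodesic hp (by omega) (by omega) hne
        · rw [G.dist_comm]; exact hfar i h1
        · exact hfar i' h2
        · omega)
      (distBall G v (3 * k)) (fun i hi => by
        have hi := mem_range.1 hi
        apply distBall_subset hG
        split_ifs with h1
        · rw [← hp0, hp _ _ (by omega) (by omega)]; omega
        · omega)
    rw [card_range] at this
    omega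
  · push Not at hfar
    obtain ⟨j, hj, hj2⟩ := hfar
    have hj0 : j ≠ 0 := by
      rintro rfl
      rw [Nat.mul_zero, hp0, G.dist_comm] at hj2
      omega
    have := le_card_distBall_of_geodesic hG hδ hp (w := w) (fun i hi => by
      have h1 := hG.dist_triangle (u := w) (v := p (3 * j)) (w := p (3 * i))
      rcases le_total i j with h | h
      · rw [G.dist_comm (u := p (3 * j)), hp _ _ (by omega) (by omega)] at h1; omega
      · rw [hp _ _ (by omega) (by omega)] at h1; omega)
    omega

/-- The ball of radius `3 * k` around `v` contains `k` unit balls which avoid all vertices near `v`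
with small balls. -/
theorem card_small_add_le_card_distBall {V : Type*} [Fintype V] {G : SimpleGraph V}
    (hG : G.Connected) {δ : ℕ} (hδ : ∀ v, δ + 1 ≤ (distBall G v 1).card) {k : ℕ} (hk : 0 < k)
    {v x : V} (hx : 3 * k ≤ G.dist v x) (C : Finset V)
    (hC : ∀ w ∈ C, G.dist v w ≤ 2 ∧ (distBall G w (3 * k)).card < (k + 1) * (δ + 1)) :
    k * (δ + 1) + C.card ≤ (distBall G v (3 * k)).card := by
  classical
  obtain ⟨p, hp0, hp⟩ := hG.exists_geodesic hx
  have hsub : C ⊆ distBall G v (3 * k) := fun w hw => mem_distBall.2 (by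
    have := (hC w hw).1; omega)
  -- With offset 2 the last unit ball just fits. Only the one around `p 2` could meet `C`, and a
  -- vertex within 1 of `p 2` is within 3k-1 of every `p (3 * i)`, so its ball is not small.
  have := card_mul_le_card_of_separated hG hδ (range k) (fun i => p (3 * i + 2))
    (fun i hi i' hi' hne => separated_of_geodesic hp
      (by have := mem_range.1 hi; omega) (by have := mem_range.1 hi'; omega) hne)
    (distBall G v (3 * k) \ C) (fun i hi w hw => by
      have hi := mem_range.1 hi
      rw [mem_sdiff]
      have hvp : G.dist v (p (3 * i + 2)) = 3 * i + 2 := by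
        rw [← hp0, hp _ _ (by omega) (by omega)]; omega
      refine ⟨distBall_subset hG (by omega) hw, fun hwC => ?_⟩
      obtain ⟨h2, h3⟩ := hC w hwC
      rw [mem_distBall] at hw
      have htri := hG.dist_triangle (u := v) (v := w) (w := p (3 * i + 2))
      rw [G.dist_comm (u := w)] at htri
      have hi0 : i = 0 := by omega
      subst hi0
      have := le_card_distBall_of_geodesic hG hδ hp (w := w) (fun i hi => by
        rcases Nat.eq_zero_or_pos i with rfl | hpos
        · rw [Nat.mul_zero, hp0, G.dist_comm]; omega
        · have h1 := hG.dist_triangle (u := w) (v := p (3 * 0 + 2)) (w := p (3 * i))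
          rw [hp (3 * 0 + 2) _ (by omega) (by omega), G.dist_comm (u := w) (v := p (3 * 0 + 2))]
            at h1
          omega)
      omega)
  rw [card_range, card_sdiff_of_subset hsub] at this
  have := card_le_card hsub
  omega

/-- Greedy choice of a separated set dominating `T`, smallest values of `β` first. -/
theorem exists_separated_dominating {V : Type*} [Fintype V] (G : SimpleGraph V) (β : V → ℕ)
    (T : Finset V) : ∃ S ⊆ T, (∀ v ∈ S, ∀ w ∈ S, v ≠ w → 3 ≤ G.dist v w) ∧
      ∀ w ∈ T, ∃ v ∈ S, G.dist v w ≤ 2 ∧ β v ≤ β w := by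
  classical
  induction T using Finset.strongInduction with
  | H T ih =>
    rcases T.eq_empty_or_nonempty with rfl | hT
    · exact ⟨∅, by simp⟩
    obtain ⟨v, hvT, hmin⟩ := T.exists_min_image β hT
    obtain ⟨S, hST, hsep, hdom⟩ := ih (T.filter fun w => 3 ≤ G.dist v w)
      (filter_ssubset.2 ⟨v, hvT, by simp⟩)
    have hS : ∀ w ∈ S, w ∈ T ∧ 3 ≤ G.dist v w := fun w hw => mem_filter.1 (hST hw)
    refine ⟨insert v S, ?_, ?_, ?_⟩
    · exact insert_subset hvT fun w hw => (hS w hw).1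
    · intro a ha b hb hab
      rcases mem_insert.1 ha with rfl | ha' <;> rcases mem_insert.1 hb with rfl | hb'
      · exact absurd rfl hab
      · exact (hS b hb').2
      · rw [G.dist_comm]; exact (hS a ha').2
      · exact hsep a ha' b hb' hab
    · intro w hw
      by_cases h : 3 ≤ G.dist v w
      · obtain ⟨u, hu, h1, h2⟩ := hdom w (mem_filter.2 ⟨hw, h⟩)
        exact ⟨u, mem_insert_of_mem hu, h1, h2⟩
      · exact ⟨v, mem_insert_self _ _, by omega, hmin w hw⟩

/-! ### Vertices near several centres -/

/-- A vertex close to three or more vertices of a `6 * m`-separated set has a very large ball. -/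
theorem le_card_distBall_of_hub {V : Type*} [Fintype V] {G : SimpleGraph V}
    (hG : G.Connected) {δ : ℕ} (hδ : ∀ v, δ + 1 ≤ (distBall G v 1).card) {m : ℕ} (hm : 0 < m)
    (F : Finset V) (hF : ∀ v ∈ F, ∀ w ∈ F, v ≠ w → 6 * m ≤ G.dist v w)
    (hcard : 2 ≤ F.card) (hecc : ∀ v ∈ F, ∃ x, 3 * (m - 1) ≤ G.dist v x) {u : V}
    (hu : ∀ v ∈ F, G.dist u v ≤ 3 * m + 1) :
    (F.card * m + 1) * (δ + 1) ≤ (distBall G u (6 * m)).card := by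
  classical
  -- `w` carries one extra unit ball. If `u` is too close to some `a`, then d(u,a) = 3m-1 and all
  -- others are at 3m+1, so one step from `u` towards any other `b` works.
  obtain ⟨w, huw, hw⟩ : ∃ w, G.dist u w ≤ 1 ∧ ∀ v ∈ F, 3 * m ≤ G.dist w v := by
    by_cases hall : ∀ v ∈ F, 3 * m ≤ G.dist u v
    · exact ⟨u, by simp, hall⟩
    push Not at hall
    obtain ⟨a, haF, ha⟩ := hall
    obtain ⟨b, hbF, hba⟩ := exists_mem_ne (by omega : 1 < F.card) a
    have hab := hF a haF b hbF hba.symm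
    have hub := hu b hbF
    have htri := hG.dist_triangle (u := a) (v := u) (w := b)
    have hau : G.dist a u = G.dist u a := G.dist_comm
    obtain ⟨q, hq⟩ := hG.exists_walk_length_eq_dist u b
    obtain ⟨w, huw, hwb⟩ : ∃ w, G.dist u w = 1 ∧ G.dist w b + 1 = G.dist u b := by
      cases q with
      | nil => simp at hq; omega
      | @cons _ w _ h q' =>
        have h1 : G.dist u w = 1 := dist_eq_one_iff_adj.2 h
        have h2 := dist_le q'
        have h3 := hG.dist_triangle (u := u) (v := w) (w := b)
        rw [Walk.length_cons] at hq
        exact ⟨w, h1, by omega⟩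
    refine ⟨w, huw.le, fun v hv => ?_⟩
    by_cases hva : v = a
    · subst hva
      have := hG.dist_triangle (u := v) (v := w) (w := b)
      rw [G.dist_comm (u := v) (v := w)] at this
      omega
    · have h1 := hF a haF v hv (Ne.symm hva)
      have h2 := hG.dist_triangle (u := a) (v := u) (w := v)
      have h3 := hG.dist_triangle (u := u) (v := w) (w := v)
      rw [G.dist_comm (u := a) (v := u)] at h2
      omega
  obtain ⟨m, rfl⟩ : ∃ m', m = m' + 1 := ⟨m - 1, by omega⟩
  have hdis : ∀ v ∈ F, ∀ v' ∈ F, v ≠ v' →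
      Disjoint (distBall G v (3 * m + 1)) (distBall G v' (3 * m + 1)) := fun v hv v' hv' hne =>
    disjoint_distBall hG (by have := hF v hv v' hv' hne; omega)
  have hdw : Disjoint (F.biUnion fun v => distBall G v (3 * m + 1)) (distBall G w 1) := by
    rw [disjoint_biUnion_left]
    intro v hv
    exact disjoint_distBall hG (by have := hw v hv; rw [G.dist_comm] at this; omega)
  have hsub : (F.biUnion fun v => distBall G v (3 * m + 1)) ∪ distBall G w 1 ⊆
      distBall G u (6 * (m + 1)) := by
    apply union_subset
    · exact biUnion_subset.2 fun v hv => distBall_subset hG (by have := hu v hv; omega)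
    · exact distBall_subset hG (by omega)
  have hle := card_le_card hsub
  rw [card_union_of_disjoint hdw, card_biUnion hdis] at hle
  have hsum : F.card * ((m + 1) * (δ + 1)) ≤ ∑ v ∈ F, (distBall G v (3 * m + 1)).card := by
    rw [← smul_eq_mul]
    exact card_nsmul_le_sum _ _ _ fun v hv => by
      obtain ⟨x, hx⟩ := hecc v hv
      exact le_card_distBall_of_le_dist hG hδ hx
  have := hδ w
  nlinarith

/-! ### Double counting -/

theorem sum_card_distBall_sub_one {V : Type*} [Fintype V] {G : SimpleGraph V}
    (hG : G.Connected) (r : ℕ) :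
    ∑ u, ((distBall G u r).card - 1 : ℝ) = 2 * ((graphPower G r).edgeSet.ncard : ℝ) := by
  classical
  have hdeg : ∀ u, ((graphPower G r).degree u : ℝ) = (distBall G u r).card - 1 := by
    intro u
    have hN : (graphPower G r).neighborFinset u = (distBall G u r).erase u := by
      ext x
      rw [mem_neighborFinset, mem_erase, mem_distBall, graphPower]
      simp only
      rw [← (hG u x).coe_dist_eq_edist, Nat.cast_le, ne_comm]
    have hu : u ∈ distBall G u r := mem_distBall.2 (by simp)
    rw [← card_neighborFinset_eq_degree, hN, card_erase_of_mem hu,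
      Nat.cast_sub (card_pos.2 ⟨u, hu⟩), Nat.cast_one]
  simp_rw [← hdeg]
  have h := (graphPower G r).sum_degrees_eq_twice_card_edges
  have h2 : (graphPower G r).edgeSet.ncard = (graphPower G r).edgeFinset.card := by
    rw [← coe_edgeFinset, Set.ncard_coe_finset]
  rw [h2]
  exact_mod_cast h

theorem sum_card_filter_dist_le {V : Type*} [Fintype V] (G : SimpleGraph V) (S : Finset V) (R : ℕ) :
    ∑ u, (S.filter fun v => G.dist u v ≤ R).card = ∑ v ∈ S, (distBall G v R).card := by
  simp_rw [distBall, card_filter]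
  rw [sum_comm]
  simp_rw [G.dist_comm]

/-- The number of vertices of a `3 * k`-separated set near `u` is controlled by the size of the ball
of radius `3 * k` around `u`. -/
theorem card_near_mul_le {V : Type*} [Fintype V] {G : SimpleGraph V}
    (hG : G.Connected) {δ : ℕ} (hδ : ∀ v, δ + 1 ≤ (distBall G v 1).card) {k : ℕ} (hk : 0 < k)
    (S : Finset V) (hS : ∀ v ∈ S, ∀ w ∈ S, v ≠ w → 3 * k ≤ G.dist v w)
    (hecc : ∀ v ∈ S, ∃ x, 3 * k ≤ G.dist v x) (u : V) :
    (δ : ℝ) * ((S.filter fun v => G.dist u v ≤ 3 * ((k - 1) / 2) + 1).card +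
        (S.filter fun v => G.dist u v ≤ 3 * (k / 2) + 1).card : ℕ) ≤
      2 * δ + 4 * (k + 1) *
        max ((distBall G u (3 * k)).card - 1 - (k + 1) * (δ : ℝ)) 0 := by
  set F₁ := S.filter fun v => G.dist u v ≤ 3 * ((k - 1) / 2) + 1 with hF₁
  set F₂ := S.filter fun v => G.dist u v ≤ 3 * (k / 2) + 1 with hF₂
  have hmax := le_max_right ((distBall G u (3 * k)).card - 1 - (k + 1) * (δ : ℝ)) 0
  have hmax' := le_max_left ((distBall G u (3 * k)).card - 1 - (k + 1) * (δ : ℝ)) 0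
  set s := max ((distBall G u (3 * k)).card - 1 - (k + 1) * (δ : ℝ)) 0
  have hδ0 : (0 : ℝ) ≤ δ := Nat.cast_nonneg _
  by_cases hsmall : F₁.card + F₂.card ≤ 2
  · have h1 : ((F₁.card + F₂.card : ℕ) : ℝ) ≤ 2 := by exact_mod_cast hsmall
    have h2 := mul_le_mul_of_nonneg_left h1 hδ0
    have h3 : 0 ≤ 4 * ((k : ℝ) + 1) * s := by positivity
    linarith
  have hsub : F₁ ⊆ F₂ := fun v hv => by
    rw [hF₁, mem_filter] at hv
    rw [hF₂, mem_filter]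
    exact ⟨hv.1, by have := hv.2; omega⟩
  -- The two radii sum to 3k-1, so a vertex in `F₁` is the only one in `F₂`.
  have hempty : F₁ = ∅ := by
    by_contra hne
    obtain ⟨v, hv⟩ := nonempty_iff_ne_empty.2 hne
    have hle : F₂.card ≤ 1 := by
      have : Nonempty V := ⟨v⟩
      rw [card_le_one_iff_subset_singleton]
      refine ⟨v, fun w hw => ?_⟩
      rw [mem_singleton]
      by_contra hwv
      rw [hF₁, mem_filter] at hv
      rw [hF₂, mem_filter] at hw
      have h1 := hS w hw.1 v hv.1 hwv
      have h2 := hG.dist_triangle (u := w) (v := u) (w := v)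
      rw [G.dist_comm (u := w) (v := u)] at h2
      have := hv.2
      have := hw.2
      omega
    have := card_le_card hsub
    omega
  rw [hempty, card_empty, zero_add] at hsmall ⊢
  obtain ⟨m, rfl | rfl⟩ : ∃ m, k = 2 * m ∨ k = 2 * m + 1 := ⟨k / 2, by omega⟩
  swap
  · have : F₁ = F₂ := by
      rw [hF₁, hF₂]
      congr! 4
      omega
    rw [← this, hempty, card_empty] at hsmall
    omega
  have hhub := le_card_distBall_of_hub hG hδ (m := m) (by omega) F₂
    (fun v hv w hw hne => by
      have := hS v (mem_filter.1 hv).1 w (mem_filter.1 hw).1 hne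
      omega)
    (by omega)
    (fun v hv => by
      obtain ⟨x, hx⟩ := hecc v (mem_filter.1 hv).1
      exact ⟨x, by omega⟩)
    (u := u)
    (fun v hv => by have := (mem_filter.1 hv).2; omega)
  have hhub' : ((F₂.card : ℝ) * m + 1) * (δ + 1) ≤ (distBall G u (3 * (2 * m))).card := by
    rw [show 3 * (2 * m) = 6 * m by ring]
    exact_mod_cast hhub
  have hm : (1 : ℝ) ≤ m := by exact_mod_cast (by omega : 1 ≤ m)
  have hf : (2 : ℝ) ≤ F₂.card := by exact_mod_cast (by omega : 2 ≤ F₂.card)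
  push_cast at hmax' ⊢
  have h1 : ((F₂.card : ℝ) - 2) * δ * m ≤ s := by
    have : (0 : ℝ) ≤ F₂.card * m := by positivity
    nlinarith
  have h2 : ((F₂.card : ℝ) - 2) * δ ≤ ((F₂.card : ℝ) - 2) * δ * m :=
    le_mul_of_one_le_right (mul_nonneg (by linarith) hδ0) hm
  have h3 : s ≤ 4 * (2 * (m : ℝ) + 1) * s := le_mul_of_one_le_left hmax (by linarith)
  linarith

/-- The total deficit of the vertices with small balls. -/
theorem exists_separated_sum_deficit_le {V : Type*} [Fintype V] {G : SimpleGraph V}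
    (hG : G.Connected) {δ : ℕ} (hδ : ∀ v, δ + 1 ≤ (distBall G v 1).card) {k : ℕ} (hk : 0 < k)
    {a b : V} (hab : 3 * k ≤ G.dist a b) :
    ∃ S : Finset V, (∀ v ∈ S, ∀ w ∈ S, v ≠ w → 3 * k ≤ G.dist v w) ∧
      (∀ v ∈ S, ∃ x, 3 * k ≤ G.dist v x) ∧
      4 * ∑ u, max ((k + 1) * (δ : ℝ) - ((distBall G u (3 * k)).card - 1)) 0 ≤
        S.card * (δ : ℝ) ^ 2 := by
  classical
  set β : V → ℕ := fun u => (distBall G u (3 * k)).card with hβ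
  -- Exactly the vertices of positive deficit.
  set T : Finset V := univ.filter fun u => β u ≤ (k + 1) * δ with hT
  have hsmall : ∀ v ∈ T, (distBall G v (3 * k)).card < (k + 1) * (δ + 1) := fun v hv => by
    have : β v ≤ (k + 1) * δ := (mem_filter.1 hv).2
    simp only [hβ] at this
    nlinarith
  have hecc : ∀ v ∈ T, ∃ x, 3 * k ≤ G.dist v x := fun v hv =>
    exists_le_dist_of_card_distBall_lt hG hδ hab le_rfl (hsmall v hv)
  obtain ⟨S, hST, hsep, hdom⟩ := exists_separated_dominating G β T
  refine ⟨S, ?_, fun v hv => hecc v (hST hv), ?_⟩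
  · intro v hv w hw hne
    obtain ⟨x, hx⟩ := hecc v (hST hv)
    have := hsep v hv w hw hne
    rcases dist_le_two_or_le_dist_of_small hG hδ hx (hsmall v (hST hv)) (hsmall w (hST hw)) with h | h
    · omega
    · exact h
  set D : V → ℝ := fun u => max ((k + 1) * (δ : ℝ) - (β u - 1)) 0 with hD
  have hD0 : ∀ u, 0 ≤ D u := fun u => le_max_right _ _
  have hDT : ∀ u ∉ T, D u = 0 := fun u hu => by
    refine max_eq_right ?_
    have h : (k + 1) * δ + 1 ≤ β u := by
      by_contra hcon
      exact hu (mem_filter.2 ⟨mem_univ _, by omega⟩)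
    have h' : ((k : ℝ) + 1) * δ + 1 ≤ β u := by exact_mod_cast h
    linarith
  change 4 * ∑ u, D u ≤ _
  have hcluster : ∀ v ∈ S, 4 * ((T.filter fun w => G.dist v w ≤ 2).card * D v) ≤ (δ : ℝ) ^ 2 := by
    intro v hv
    obtain ⟨x, hx⟩ := hecc v (hST hv)
    have h := card_small_add_le_card_distBall hG hδ hk hx (T.filter fun w => G.dist v w ≤ 2)
      (fun w hw => ⟨(mem_filter.1 hw).2, hsmall w (mem_filter.1 hw).1⟩)
    set c := (T.filter fun w => G.dist v w ≤ 2).card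
    have h' : (k : ℝ) * (δ + 1) + c ≤ β v := by exact_mod_cast h
    have hk' : (1 : ℝ) ≤ k := by exact_mod_cast hk
    have hc : (0 : ℝ) ≤ c := Nat.cast_nonneg _
    rcases max_choice ((k + 1) * (δ : ℝ) - (β v - 1)) 0 with hm | hm
    · have hDv : D v + c ≤ δ := by
        simp only [hD]
        rw [hm]
        linarith
      have := hD0 v
      -- AM-GM: 4cD ≤ (D + c)² ≤ δ².
      nlinarith [sq_nonneg (D v - c)]
    · have : D v = 0 := hm
      rw [this]
      simp only [mul_zero]
      positivity
  have hsum : ∑ u, D u ≤ ∑ v ∈ S, (T.filter fun w => G.dist v w ≤ 2).card * D v := by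
    calc ∑ u, D u = ∑ u ∈ T, D u := (sum_subset (subset_univ T) fun u _ hu => hDT u hu).symm
      _ ≤ ∑ u ∈ T, ∑ v ∈ S, if G.dist v u ≤ 2 then D v else 0 := by
        refine sum_le_sum fun u hu => ?_
        obtain ⟨v, hv, h1, h2⟩ := hdom u hu
        have h3 : D u ≤ D v := by
          have : (β v : ℝ) ≤ β u := by exact_mod_cast h2
          exact max_le_max (by linarith) le_rfl
        calc D u ≤ if G.dist v u ≤ 2 then D v else 0 := by rw [if_pos h1]; exact h3
          _ ≤ _ := single_le_sum (f := fun v => if G.dist v u ≤ 2 then D v else 0)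
            (fun w _ => by split_ifs; exacts [hD0 w, le_rfl]) hv
      _ = _ := by
        rw [sum_comm]
        refine sum_congr rfl fun v _ => ?_
        rw [← sum_filter, sum_const, nsmul_eq_mul]
  calc 4 * ∑ u, D u ≤ ∑ v ∈ S, 4 * ((T.filter fun w => G.dist v w ≤ 2).card * D v) := by
        rw [← mul_sum]; linarith
    _ ≤ ∑ _v ∈ S, (δ : ℝ) ^ 2 := sum_le_sum hcluster
    _ = S.card * (δ : ℝ) ^ 2 := by simp

/-- Both sides of the balance carry 4(k+1): the surplus allowed in `card_near_mul_le` cancels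
against the total surplus, leaving a net loss of at most δ|V|/(2(k+1)). -/
theorem le_sum_card_distBall {V : Type*} [Fintype V] {G : SimpleGraph V}
    (hG : G.Connected) {δ : ℕ} (hδ : ∀ v, δ + 1 ≤ (distBall G v 1).card) {k : ℕ} (hk : 0 < k)
    {a b : V} (hab : 3 * k ≤ G.dist a b) :
    (2 * ((k : ℝ) + 1) ^ 2 - 1) * δ * Fintype.card V ≤
      2 * (k + 1) * ∑ u, ((distBall G u (3 * k)).card - 1 : ℝ) := by
  obtain ⟨S, hS, hecc, hdef⟩ := exists_separated_sum_deficit_le hG hδ hk hab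
  have hnear := sum_le_sum fun u (_ : u ∈ univ) => card_near_mul_le hG hδ hk S hS hecc u
  rw [← mul_sum, ← Nat.cast_sum, sum_add_distrib, sum_card_filter_dist_le, sum_card_filter_dist_le,
    sum_add_distrib, ← mul_sum, sum_const, card_univ, nsmul_eq_mul, ← mul_sum] at hnear
  have hballs : S.card * ((k + 1) * (δ + 1)) ≤ ∑ v ∈ S, (distBall G v (3 * ((k - 1) / 2) + 1)).card +
      ∑ v ∈ S, (distBall G v (3 * (k / 2) + 1)).card := by
    rw [← sum_add_distrib, ← smul_eq_mul]
    refine card_nsmul_le_sum _ _ _ fun v hv => ?_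
    obtain ⟨x, hx⟩ := hecc v hv
    have h1 := le_card_distBall_of_le_dist hG hδ (v := v) (x := x) (j := (k - 1) / 2) (by omega)
    have h2 := le_card_distBall_of_le_dist hG hδ (v := v) (x := x) (j := k / 2) (by omega)
    -- Two radii are used so that, for either parity of `k`, the balls at `v` together count k+1
    -- unit balls.
    have h3 : k + 1 = ((k - 1) / 2 + 1) + (k / 2 + 1) := by omega
    rw [h3, add_mul]
    exact add_le_add h1 h2
  have hballs' : (S.card : ℝ) * ((k + 1) * (δ + 1)) ≤
      ((∑ v ∈ S, (distBall G v (3 * ((k - 1) / 2) + 1)).card +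
        ∑ v ∈ S, (distBall G v (3 * (k / 2) + 1)).card : ℕ) : ℝ) := by exact_mod_cast hballs
  have hsplit : ∑ u, ((distBall G u (3 * k)).card - 1 : ℝ) =
      ∑ u, max ((distBall G u (3 * k)).card - 1 - (k + 1) * (δ : ℝ)) 0 -
      ∑ u, max ((k + 1) * (δ : ℝ) - ((distBall G u (3 * k)).card - 1)) 0 +
      Fintype.card V * ((k + 1) * (δ : ℝ)) := by
    rw [← card_univ, ← nsmul_eq_mul, ← sum_const, ← sum_sub_distrib, ← sum_add_distrib]
    refine sum_congr rfl fun u _ => ?_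
    rcases le_total ((distBall G u (3 * k)).card - 1 : ℝ) ((k + 1) * (δ : ℝ)) with h | h
    · rw [max_eq_right (by linarith), max_eq_left (by linarith)]; ring
    · rw [max_eq_left (by linarith), max_eq_right (by linarith)]; ring
  rw [hsplit]
  set P := ∑ u, max ((distBall G u (3 * k)).card - 1 - (k + 1) * (δ : ℝ)) 0
  set N := ∑ u, max ((k + 1) * (δ : ℝ) - ((distBall G u (3 * k)).card - 1)) 0
  have hδ0 : (0 : ℝ) ≤ δ := Nat.cast_nonneg _
  have hk0 : (0 : ℝ) ≤ (k : ℝ) + 1 := by positivity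
  have e1 := mul_le_mul_of_nonneg_left hballs' hδ0
  have e2 := mul_le_mul_of_nonneg_left hdef hk0
  have e3 : 0 ≤ (S.card : ℝ) * (k + 1) * δ := by positivity
  linarith

/-! ### The edge bounds -/

theorem minDegree_add_one_le_card_distBall {V : Type*} [Fintype V] (G : SimpleGraph V)
    [DecidableRel G.Adj] (v : V) : G.minDegree + 1 ≤ (distBall G v 1).card := by
  classical
  have h : insert v (G.neighborFinset v) ⊆ distBall G v 1 := by
    intro x hx
    rw [mem_distBall]
    rcases mem_insert.1 hx with rfl | hx
    · simp
    · exact (dist_eq_one_iff_adj.2 ((mem_neighborFinset ..).1 hx)).le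
  have h2 := card_le_card h
  rw [card_insert_of_notMem (by simp), card_neighborFinset_eq_degree] at h2
  have := G.minDegree_le_degree v
  omega

theorem theorem4 {V : Type*} [Fintype V] (G : SimpleGraph V) [DecidableRel G.Adj]
    (hG : G.Connected) (r : ℕ) (hr : 0 < r) (hdiam : r ≤ G.diam) :
    (r % 3 = 0 →
      (((r : ℝ) + 3) / 6 - 3 / (4 * ((r : ℝ) + 3))) * (G.minDegree : ℝ) * (Fintype.card V : ℝ)
        ≤ ((graphPower G r).edgeSet.ncard : ℝ)) ∧
    (r % 3 ≠ 0 →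
      (1 / 2 : ℝ) * (⌈(r : ℝ) / 3⌉ : ℝ) * (G.minDegree : ℝ) * (Fintype.card V : ℝ)
        ≤ ((graphPower G r).edgeSet.ncard : ℝ)) := by
  have hδ := minDegree_add_one_le_card_distBall G
  have hedges := sum_card_distBall_sub_one hG r
  have := hG.nonempty
  obtain ⟨a, b, hab⟩ := G.exists_dist_eq_diam
  rw [← hab] at hdiam
  constructor
  · intro h
    obtain ⟨k, rfl⟩ : ∃ k, r = 3 * k := ⟨r / 3, by omega⟩
    have hmain := le_sum_card_distBall hG hδ (by omega) hdiam
    rw [hedges] at hmain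
    have hk0 : (0 : ℝ) < (k : ℝ) + 1 := by positivity
    have hcoef : ((3 * k : ℕ) + 3 : ℝ) / 6 - 3 / (4 * ((3 * k : ℕ) + 3 : ℝ)) =
        (2 * ((k : ℝ) + 1) ^ 2 - 1) / (4 * (k + 1)) := by
      push_cast
      rw [show (3 * (k : ℝ) + 3) = 3 * (k + 1) by ring]
      field_simp
      ring
    rw [hcoef, mul_assoc, div_mul_eq_mul_div, div_le_iff₀ (by positivity)]
    linarith
  · intro h
    obtain ⟨k, hk1, hk2⟩ : ∃ k, 3 * k + 1 ≤ r ∧ r ≤ 3 * k + 2 := ⟨r / 3, by omega, by omega⟩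
    have hceil : ⌈(r : ℝ) / 3⌉ = (k : ℤ) + 1 := by
      have h1 : (3 * k + 1 : ℝ) ≤ r := by exact_mod_cast hk1
      have h2 : (r : ℝ) ≤ 3 * k + 2 := by exact_mod_cast hk2
      rw [Int.ceil_eq_iff]
      push_cast
      constructor <;> linarith
    have hsum : ∑ _u : V, ((k : ℝ) + 1) * G.minDegree ≤ ∑ u, ((distBall G u r).card - 1 : ℝ) := by
      refine sum_le_sum fun u _ => ?_
      have h1 : ((k : ℝ) + 1) * (G.minDegree + 1) ≤ (distBall G u r).card := by
        exact_mod_cast le_card_distBall hG hδ (by omega : 3 * k ≤ G.dist a b) hk1 u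
      have h2 : (0 : ℝ) ≤ k := Nat.cast_nonneg _
      linarith
    rw [hedges, sum_const, card_univ, nsmul_eq_mul] at hsum
    rw [hceil]
    push_cast
    linarith
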